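/- **Algebras.** A *PSI-algebra* is a Boolean algebra $A$ with an operation $\Diamond\colon A^3\to A$ such that, for all $a,b,c,d,e,f,x\in A$: $\Diamond(0,b,c)=\Diamond(a,0,c)=\Diamond(a,b,0)=0$; $\Diamond(a\vee x,b,c)=\Diamond(a,b,c)\vee\Diamond(x,b,c)$; $\Diamond(a,b\vee x,c)=\Diamond(a,b,c)\vee\Diamond(a,x,c)$; $\Diamond(a,b,c)\vee\Diamond(a,b,x)\le\Diamond(a,b,c\vee x)$; $\Diamond(a,b,f)\le\Diamond(a,b,\neg d)\vee\Diamond(a,b,\neg e)\vee\Diamond(d,e,f)$; $\Diamond(a,b,\neg a)=0$; $a\wedge f\le\Diamond(a,a,f)$; $\Diamond(a,b,f)\le\Diamond(b,a,f)$. A Boolean homomorphism $h\colon A\to B$ between PSI-algebras is a *semi-homomorphism* if $h(\Diamond_A(a,b,c))\le\Diamond_B(h(a),h(b),h(c))$ for all $a,b,c$, a *hemi-homomorphism* if $\Diamond_B(h(a),h(b),h(c))\le h(\Diamond_A(a,b,c))$ for all $a,b,c$, and a *homomorphism* if it is both. **Spaces.** For a Boolean (compact Hausdorff totally disconnected) space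 $X$ let $\mathscr{CO}(X)$ be its Boolean algebra of clopen sets and $\mathscr{C}_0(X)$ its set of nonempty closed subsets. For triples of subsets, $\vec Y\subseteq\vec Z$ means $Y_i\subseteq Z_i$ for all $i$, and $\vec Y\cap\vec U\ne\emptyset$ means $Y_i\cap U_i\neq\emptyset$ for some $i$. For $R\subseteq X\times\mathscr{C}_0(X)^3$ put $R(x)=\{\vec Y:(x,\vec Y)\in R\}$, $R^{-1}(\vec Y)=\{x:(x,\vec Y)\in R\}$ (so $R^{-1}(\vec Y)=\emptyset$ if some $Y_i=\emptyset$), and for $\vec U\in\mathscr{CO}(X)^3$ put $L_{\vec U}=\{\vec Y\in\mathscr{C}_0(X)^3:\vec Y\cap\vec U\ne\emptyset\}$, $\Diamond_R(\vec U)=\{x:\exists\,\vec Y\in R(x),\ \vec Y\subseteq\vec U\}$ and $\Box_R(\vec U)=\{x:R(x)\subseteq L_{\vec U}\}$. A *PSI-space* is a Boolean space $X$ with $R\subseteq X\times\mathscr{C}_0(X)^3$ such that - $\Diamond_R(\vec U)\in\mathscr{CO}(X)$ for all $\vec U\in\mathscr{CO}(X)^3$; - $R(x)=\bigcap\{L_{\vec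 U}:\vec U\in\mathscr{CO}(X)^3,\ x\in\Box_R(\vec U)\}$ for all $x\in X$; - if $\vec Y\in R(x)$, then $(\{y_1\},\{y_2\},Y_3)\in R(x)$ for some $y_1\in Y_1$, $y_2\in Y_2$; - for all $Y_1,Y_2,Y_3,Z,W\in\mathscr{C}_0(X)$: $R^{-1}(Y_1,Y_2,Y_3)\subseteq R^{-1}(Y_1,Y_2,Z)\cup R^{-1}(Y_1,Y_2,W)\cup R^{-1}(\mathrm{cl}(Z^c),\mathrm{cl}(W^c),Y_3)$; if $Y_1\cap Y_3=\emptyset$ then $R^{-1}(Y_1,Y_2,Y_3)=\emptyset$; $Y_1\cap Y_2\subseteq R^{-1}(Y_1,Y_1,Y_2)$; and $R^{-1}(Y_1,Y_2,Y_3)\subseteq R^{-1}(Y_2,Y_1,Y_3)$. Let $f\colon X_1\to X_2$ be a map between PSI-spaces such that $f^{-1}[U]\in\mathscr{CO}(X_1)$ for all $U\in\mathscr{CO}(X_2)$, and write $f[\vec Y]=(f[Y_1],f[Y_2],f[Y_3])$. Then $f$ is a *semi-PSI map* if, whenever $(f(x),\vec Z)\in R_2$, there is $\vec Y\in R_1(x)$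 with $f[\vec Y]\subseteq\vec Z$; it is a *hemi-PSI map* if $(x,\vec Y)\in R_1$ implies $(f(x),f[\vec Y])\in R_2$; and it is a *PSI map* if it is both. **Theorem.** The categories of PSI-algebras with semi-homomorphisms, with hemi-homomorphisms, and with homomorphisms are dually equivalent to the categories of PSI-spaces with semi-PSI maps, with hemi-PSI maps, and with PSI maps, respectively. In each of the three cases a dual equivalence is given by the following mutually quasi-inverse contravariant functors, which are well defined. One sends a PSI-algebra $(A,\Diamond)$ to the Stone space $\mathrm{Ul}(A)$ of its ultrafilters with the relation $R_\Diamond$, where for $\vec Y\in\mathscr{C}_0(\mathrm{Ul}(A))^3$ we have $(U,\vec Y)\in R_\Diamond$ iff $\Diamond(a_1,a_2,a_3)\in U$ for all $a_1,a_2,a_3\in A$ such that, for $i=1,2,3$, $a_i$ belongs to every ultrafilter in $Y_i$; it sends a morphism $h$ to $U\mapsto h^{-1}[U]$. The other sends a PSI-space $(X,R)$ to $(\mathscr{CO}(X),\Diamond_R)$ and a map $f$ to $V\mapsto f^{-1}[V]$. -/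

import Mathlib

open CategoryTheory Opposite TopologicalSpace

universe u

namespace PSI

/-! ### Pseudo-inference algebras -/

/-- A ternary weakly normal monotonic operator on a Boolean algebra. -/
structure Is3BAMO (A : Type u) [BooleanAlgebra A] (dia : A → A → A → A) : Prop where
  bot_left : ∀ b c, dia ⊥ b c = ⊥
  bot_mid : ∀ a c, dia a ⊥ c = ⊥
  bot_right : ∀ a b, dia a b ⊥ = ⊥
  sup_left : ∀ a x b c, dia (a ⊔ x) b c = dia a b c ⊔ dia x b c
  sup_mid : ∀ a b x c, dia a (b ⊔ x) c = dia a b c ⊔ dia a x c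
  le_sup_right : ∀ a b c x, dia a b c ⊔ dia a b x ≤ dia a b (c ⊔ x)

/-- The operator `dia` makes the Boolean algebra `A` a PSI-algebra. -/
structure IsPSIAlgebra (A : Type u) [BooleanAlgebra A] (dia : A → A → A → A) : Prop
    extends Is3BAMO A dia where
  pi1 : ∀ a b d e f, dia a b f ≤ dia a b dᶜ ⊔ dia a b eᶜ ⊔ dia d e f
  pi2 : ∀ a b, dia a b aᶜ = ⊥
  pi3 : ∀ a f, a ⊓ f ≤ dia a a f
  pi4 : ∀ a b f, dia a b f ≤ dia b a f

/-- A PSI-algebra. -/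
structure Alg where
  carrier : Type u
  [boolAlg : BooleanAlgebra carrier]
  dia : carrier → carrier → carrier → carrier
  isPSI : IsPSIAlgebra carrier dia

instance : CoeSort Alg.{u} (Type u) := ⟨Alg.carrier⟩

instance (A : Alg.{u}) : BooleanAlgebra A := A.boolAlg

/-- PSI semi-homomorphisms (among the Boolean homomorphisms). -/
def IsSemiHom {A B : Alg.{u}} (h : BoundedLatticeHom A B) : Prop :=
  ∀ a b c, h (A.dia a b c) ≤ B.dia (h a) (h b) (h c)

/-- PSI hemi-homomorphisms. -/
def IsHemiHom {A B : Alg.{u}} (h : BoundedLatticeHom A B) : Prop :=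
  ∀ a b c, B.dia (h a) (h b) (h c) ≤ h (A.dia a b c)

/-- PSI homomorphisms. -/
def IsPSIHom {A B : Alg.{u}} (h : BoundedLatticeHom A B) : Prop :=
  ∀ a b c, h (A.dia a b c) = B.dia (h a) (h b) (h c)

/-! ### Pseudo-inference spaces -/

section Relation

variable {X : Type u} [TopologicalSpace X]

/-- Membership in the family of nonempty closed subsets of `X`. -/
def C0 (Y : Set X) : Prop := IsClosed Y ∧ Y.Nonempty

/-- Two triples of subsets meet if they meet in *some* coordinate. For a triple `Y` of nonempty
closed sets and a triple `U` of clopen sets this says that `Y` belongs to `L_U`. -/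
def Meets (Y₁ Y₂ Y₃ U₁ U₂ U₃ : Set X) : Prop :=
  (Y₁ ∩ U₁).Nonempty ∨ (Y₂ ∩ U₂).Nonempty ∨ (Y₃ ∩ U₃).Nonempty

/-- `◇_R(U) = {x | R(x) is not disjoint from the complement of L_{Uᶜ}}`. -/
def diaRel (R : X → Set X → Set X → Set X → Prop) (U₁ U₂ U₃ : Set X) : Set X :=
  {x | ∃ Y₁ Y₂ Y₃, R x Y₁ Y₂ Y₃ ∧ ¬ Meets Y₁ Y₂ Y₃ U₁ᶜ U₂ᶜ U₃ᶜ}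

/-- `□_R(U) = {x | R(x) ⊆ L_U}`. -/
def boxRel (R : X → Set X → Set X → Set X → Prop) (U₁ U₂ U₃ : Set X) : Set X :=
  {x | ∀ Y₁ Y₂ Y₃, R x Y₁ Y₂ Y₃ → Meets Y₁ Y₂ Y₃ U₁ U₂ U₃}

/-- `R⁻¹(Y) = {x | (x, Y) ∈ R}`. -/
def relInv (R : X → Set X → Set X → Set X → Prop) (Y₁ Y₂ Y₃ : Set X) : Set X :=
  {x | R x Y₁ Y₂ Y₃}

end Relation

/-- Descriptive PSI-frames. The relation `R ⊆ X × C₀(X)³` is given on all triples of subsets and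
required, by `rel_C0`, to hold only at triples of nonempty closed sets. -/
structure IsPSIFrame (X : Type u) [TopologicalSpace X]
    (R : X → Set X → Set X → Set X → Prop) : Prop where
  compact : CompactSpace X
  hausdorff : T2Space X
  totallyDisconnected : TotallyDisconnectedSpace X
  rel_C0 : ∀ x Y₁ Y₂ Y₃, R x Y₁ Y₂ Y₃ → C0 Y₁ ∧ C0 Y₂ ∧ C0 Y₃
  df1 : ∀ U₁ U₂ U₃ : Set X, IsClopen U₁ → IsClopen U₂ → IsClopen U₃ →
    IsClopen (diaRel R U₁ U₂ U₃)
  df2 : ∀ x Y₁ Y₂ Y₃, C0 Y₁ → C0 Y₂ → C0 Y₃ →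
    (R x Y₁ Y₂ Y₃ ↔ ∀ U₁ U₂ U₃ : Set X, IsClopen U₁ → IsClopen U₂ → IsClopen U₃ →
      x ∈ boxRel R U₁ U₂ U₃ → Meets Y₁ Y₂ Y₃ U₁ U₂ U₃)
  df3 : ∀ x Y₁ Y₂ Y₃, R x Y₁ Y₂ Y₃ → ∃ y₁ ∈ Y₁, ∃ y₂ ∈ Y₂, R x {y₁} {y₂} Y₃

/-- PSI-spaces. -/
structure IsPSISpace (X : Type u) [TopologicalSpace X]
    (R : X → Set X → Set X → Set X → Prop) : Prop extends IsPSIFrame X R where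
  pif1 : ∀ Y₁ Y₂ Y₃ Z W : Set X, C0 Y₁ → C0 Y₂ → C0 Y₃ → C0 Z → C0 W →
    relInv R Y₁ Y₂ Y₃ ⊆
      relInv R Y₁ Y₂ Z ∪ relInv R Y₁ Y₂ W ∪ relInv R (closure Zᶜ) (closure Wᶜ) Y₃
  pif2 : ∀ Y₁ Y₂ Y₃ : Set X, C0 Y₁ → C0 Y₂ → C0 Y₃ → Y₁ ∩ Y₃ = ∅ → relInv R Y₁ Y₂ Y₃ = ∅
  pif3 : ∀ Y₁ Y₂ : Set X, C0 Y₁ → C0 Y₂ → Y₁ ∩ Y₂ ⊆ relInv R Y₁ Y₁ Y₂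
  pif4 : ∀ Y₁ Y₂ Y₃ : Set X, C0 Y₁ → C0 Y₂ → C0 Y₃ → relInv R Y₁ Y₂ Y₃ ⊆ relInv R Y₂ Y₁ Y₃

/-- A PSI-space. -/
structure Space where
  carrier : Type u
  [top : TopologicalSpace carrier]
  rel : carrier → Set carrier → Set carrier → Set carrier → Prop
  isPSI : IsPSISpace carrier rel

instance : CoeSort Space.{u} (Type u) := ⟨Space.carrier⟩

instance (X : Space.{u}) : TopologicalSpace X := X.top

section Maps

variable {X₁ X₂ : Type u} [TopologicalSpace X₁] [TopologicalSpace X₂]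

/-- Preimages of clopen sets are clopen. -/
def PreservesClopen (f : X₁ → X₂) : Prop := ∀ U : Set X₂, IsClopen U → IsClopen (f ⁻¹' U)

/-- Back condition: if `(f x, Z) ∈ R₂`, then some `Y ∈ R₁(x)` satisfies `f[Y] ⊆ Z`. -/
def Back (R₁ : X₁ → Set X₁ → Set X₁ → Set X₁ → Prop) (R₂ : X₂ → Set X₂ → Set X₂ → Set X₂ → Prop)
    (f : X₁ → X₂) : Prop :=
  ∀ x Z₁ Z₂ Z₃, R₂ (f x) Z₁ Z₂ Z₃ →
    ∃ Y₁ Y₂ Y₃, R₁ x Y₁ Y₂ Y₃ ∧ f '' Y₁ ⊆ Z₁ ∧ f '' Y₂ ⊆ Z₂ ∧ f '' Y₃ ⊆ Z₃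

/-- Forth condition: if `(x, Y) ∈ R₁`, then `(f x, f[Y]) ∈ R₂`. -/
def Forth (R₁ : X₁ → Set X₁ → Set X₁ → Set X₁ → Prop) (R₂ : X₂ → Set X₂ → Set X₂ → Set X₂ → Prop)
    (f : X₁ → X₂) : Prop :=
  ∀ x Y₁ Y₂ Y₃, R₁ x Y₁ Y₂ Y₃ → R₂ (f x) (f '' Y₁) (f '' Y₂) (f '' Y₃)

/-- Semi-PSI maps (the maps dual to PSI semi-homomorphisms). -/
def IsSemiMap (R₁ : X₁ → Set X₁ → Set X₁ → Set X₁ → Prop)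
    (R₂ : X₂ → Set X₂ → Set X₂ → Set X₂ → Prop) (f : X₁ → X₂) : Prop :=
  PreservesClopen f ∧ Back R₁ R₂ f

/-- Hemi-PSI maps (the maps dual to PSI hemi-homomorphisms). -/
def IsHemiMap (R₁ : X₁ → Set X₁ → Set X₁ → Set X₁ → Prop)
    (R₂ : X₂ → Set X₂ → Set X₂ → Set X₂ → Prop) (f : X₁ → X₂) : Prop :=
  PreservesClopen f ∧ Forth R₁ R₂ f

/-- PSI maps. -/
def IsPSIMap (R₁ : X₁ → Set X₁ → Set X₁ → Set X₁ → Prop)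
    (R₂ : X₂ → Set X₂ → Set X₂ → Set X₂ → Prop) (f : X₁ → X₂) : Prop :=
  IsSemiMap R₁ R₂ f ∧ IsHemiMap R₁ R₂ f

end Maps

/-! ### The three categories on each side -/

/-- The three kinds of morphisms. -/
inductive Kind
  | semi
  | hemi
  | full

/-- The algebra morphisms of the given kind. -/
def IsAlgMor {A B : Alg.{u}} : Kind → BoundedLatticeHom A B → Prop
  | .semi => IsSemiHom
  | .hemi => IsHemiHom
  | .full => IsPSIHom

/-- The maps of the given kind. -/
def IsSpMor {X₁ X₂ : Type u} [TopologicalSpace X₁] [TopologicalSpace X₂] :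
    Kind → (X₁ → Set X₁ → Set X₁ → Set X₁ → Prop) → (X₂ → Set X₂ → Set X₂ → Set X₂ → Prop) →
      (X₁ → X₂) → Prop
  | .semi => IsSemiMap
  | .hemi => IsHemiMap
  | .full => IsPSIMap

theorem isAlgMor_id (j : Kind) (A : Alg.{u}) : IsAlgMor j (BoundedLatticeHom.id A) := by
  cases j <;> intro a b c
  · exact le_refl (A.dia a b c)
  · exact le_refl (A.dia a b c)
  · rfl

theorem isAlgMor_comp {j : Kind} {A B C : Alg.{u}} {g : BoundedLatticeHom B C}
    {f : BoundedLatticeHom A B} (hg : IsAlgMor j g) (hf : IsAlgMor j f) :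
    IsAlgMor j (g.comp f) := by
  cases j <;> intro a b c
  · exact (OrderHomClass.mono g (hf a b c)).trans (hg _ _ _)
  · exact (hg _ _ _).trans (OrderHomClass.mono g (hf a b c))
  · exact (congrArg g (hf a b c)).trans (hg _ _ _)

section MapLemmas

variable {X₁ X₂ X₃ : Type u} [TopologicalSpace X₁] [TopologicalSpace X₂] [TopologicalSpace X₃]
  {R₁ : X₁ → Set X₁ → Set X₁ → Set X₁ → Prop} {R₂ : X₂ → Set X₂ → Set X₂ → Set X₂ → Prop}
  {R₃ : X₃ → Set X₃ → Set X₃ → Set X₃ → Prop}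

theorem isSemiMap_id : IsSemiMap R₁ R₁ id :=
  ⟨fun _ hU => hU, fun _ Z₁ Z₂ Z₃ h => ⟨Z₁, Z₂, Z₃, h, by simp, by simp, by simp⟩⟩

theorem isHemiMap_id : IsHemiMap R₁ R₁ id :=
  ⟨fun _ hU => hU, fun _ Y₁ Y₂ Y₃ h => by simpa using h⟩

theorem isSemiMap_comp {g : X₂ → X₃} {f : X₁ → X₂} (hg : IsSemiMap R₂ R₃ g)
    (hf : IsSemiMap R₁ R₂ f) : IsSemiMap R₁ R₃ (g ∘ f) := by
  refine ⟨fun U hU => hf.1 _ (hg.1 U hU), fun x Z₁ Z₂ Z₃ h => ?_⟩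
  obtain ⟨Y₁, Y₂, Y₃, hY, h₁, h₂, h₃⟩ := hg.2 _ _ _ _ h
  obtain ⟨T₁, T₂, T₃, hT, k₁, k₂, k₃⟩ := hf.2 _ _ _ _ hY
  refine ⟨T₁, T₂, T₃, hT, ?_, ?_, ?_⟩ <;> rw [Set.image_comp]
  · exact (Set.image_mono k₁).trans h₁
  · exact (Set.image_mono k₂).trans h₂
  · exact (Set.image_mono k₃).trans h₃

theorem isHemiMap_comp {g : X₂ → X₃} {f : X₁ → X₂} (hg : IsHemiMap R₂ R₃ g)
    (hf : IsHemiMap R₁ R₂ f) : IsHemiMap R₁ R₃ (g ∘ f) := by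
  refine ⟨fun U hU => hf.1 _ (hg.1 U hU), fun x Y₁ Y₂ Y₃ h => ?_⟩
  rw [Set.image_comp, Set.image_comp, Set.image_comp]
  exact hg.2 _ _ _ _ (hf.2 _ _ _ _ h)

theorem isSpMor_id (j : Kind) : IsSpMor j R₁ R₁ id := by
  cases j
  · exact isSemiMap_id
  · exact isHemiMap_id
  · exact ⟨isSemiMap_id, isHemiMap_id⟩

theorem isSpMor_comp {j : Kind} {g : X₂ → X₃} {f : X₁ → X₂} (hg : IsSpMor j R₂ R₃ g)
    (hf : IsSpMor j R₁ R₂ f) : IsSpMor j R₁ R₃ (g ∘ f) := by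
  cases j
  · exact isSemiMap_comp hg hf
  · exact isHemiMap_comp hg hf
  · exact ⟨isSemiMap_comp hg.1 hf.1, isHemiMap_comp hg.2 hf.2⟩

theorem isSpMor_preservesClopen {j : Kind} {f : X₁ → X₂} (hf : IsSpMor j R₁ R₂ f) :
    PreservesClopen f := by
  cases j
  · exact hf.1
  · exact hf.1
  · exact hf.1.1

end MapLemmas

/-- The category with all PSI-algebras as objects and morphisms of kind `j`. -/
structure AlgCat (j : Kind) where
  alg : Alg.{u}

/-- The category with all PSI-spaces as objects and morphisms of kind `j`. -/
structure SpCat (j : Kind) where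
  space : Space.{u}

/-- Morphisms of kind `j` between PSI-algebras. -/
@[ext]
structure AlgMor (j : Kind) (A B : Alg.{u}) where
  hom : BoundedLatticeHom A B
  isMor : IsAlgMor j hom

/-- Morphisms of kind `j` between PSI-spaces. -/
@[ext]
structure SpMor (j : Kind) (X Y : Space.{u}) where
  map : X → Y
  isMor : IsSpMor j X.rel Y.rel map

instance (j : Kind) : Category.{u} (AlgCat.{u} j) where
  Hom A B := AlgMor j A.alg B.alg
  id A := ⟨BoundedLatticeHom.id A.alg, isAlgMor_id j A.alg⟩
  comp f g := ⟨g.hom.comp f.hom, isAlgMor_comp g.isMor f.isMor⟩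

instance (j : Kind) : Category.{u} (SpCat.{u} j) where
  Hom X Y := SpMor j X.space Y.space
  id _ := ⟨id, isSpMor_id j⟩
  comp f g := ⟨g.map ∘ f.map, isSpMor_comp g.isMor f.isMor⟩

/-! ### From algebras to spaces -/

/-- Ultrafilters of a Boolean algebra. -/
@[ext]
structure Ult (A : Type u) [BooleanAlgebra A] where
  carrier : Set A
  top_mem : ⊤ ∈ carrier
  bot_notMem : ⊥ ∉ carrier
  inf_mem : ∀ a b, a ∈ carrier → b ∈ carrier → a ⊓ b ∈ carrier
  mem_of_le : ∀ a b, a ∈ carrier → a ≤ b → b ∈ carrier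
  mem_or_compl_mem : ∀ a, a ∈ carrier ∨ aᶜ ∈ carrier

/-- The Stone map. -/
def stone {A : Type u} [BooleanAlgebra A] (a : A) : Set (Ult A) := {U | a ∈ U.carrier}

/-- The Stone topology. -/
instance (A : Type u) [BooleanAlgebra A] : TopologicalSpace (Ult A) :=
  generateFrom (Set.range stone)

/-- The filter `F_Y` of a set `Y` of ultrafilters. -/
def filterOf {A : Type u} [BooleanAlgebra A] (Y : Set (Ult A)) : Set A := {a | Y ⊆ stone a}

/-- The relation `R_◇`: `(U, Y) ∈ R_◇` iff `F_{Y₁} × F_{Y₂} × F_{Y₃} ⊆ ◇⁻¹[U]`, for triples of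
nonempty closed sets. -/
def ultRel {A : Type u} [BooleanAlgebra A] (dia : A → A → A → A) (U : Ult A)
    (Y₁ Y₂ Y₃ : Set (Ult A)) : Prop :=
  C0 Y₁ ∧ C0 Y₂ ∧ C0 Y₃ ∧
    ∀ a ∈ filterOf Y₁, ∀ b ∈ filterOf Y₂, ∀ c ∈ filterOf Y₃, dia a b c ∈ U.carrier

/-- The map `h⁻¹` between ultrafilters. -/
def Ult.comap {A B : Type u} [BooleanAlgebra A] [BooleanAlgebra B] (h : BoundedLatticeHom A B)
    (U : Ult B) : Ult A where
  carrier := h ⁻¹' U.carrier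
  top_mem := by simpa using U.top_mem
  bot_notMem := by simpa using U.bot_notMem
  inf_mem a b ha hb := by simpa using U.inf_mem _ _ ha hb
  mem_of_le a b ha hab := U.mem_of_le _ _ ha (OrderHomClass.mono h hab)
  mem_or_compl_mem a := by simpa using U.mem_or_compl_mem (h a)

/-- The assignment `(B, ◇) ↦ (Ult(B), R_◇)`, `h ↦ h⁻¹`, as a functor, given that it is well
defined on objects (`hobj`) and on morphisms (`hmap`). -/
def ultFunctor (j : Kind)
    (hobj : ∀ A : Alg.{u}, IsPSISpace (Ult A) (ultRel A.dia))
    (hmap : ∀ (A B : Alg.{u}) (h : BoundedLatticeHom A B), IsAlgMor j h →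
      IsSpMor j (ultRel B.dia) (ultRel A.dia) (Ult.comap h)) :
    (AlgCat.{u} j)ᵒᵖ ⥤ SpCat.{u} j where
  obj A := ⟨⟨Ult A.unop.alg, ultRel A.unop.alg.dia, hobj A.unop.alg⟩⟩
  map h := ⟨Ult.comap h.unop.hom, hmap _ _ _ h.unop.isMor⟩
  map_id _ := rfl
  map_comp _ _ := rfl

/-! ### From spaces to algebras -/

/-- The operator `◇_R` on the clopen algebra of a PSI-space. -/
def Space.dia (X : Space.{u}) (U₁ U₂ U₃ : Clopens X) : Clopens X :=
  ⟨diaRel X.rel U₁ U₂ U₃, X.isPSI.df1 _ _ _ U₁.isClopen U₂.isClopen U₃.isClopen⟩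

/-- The Boolean homomorphism `U ↦ f⁻¹[U]` between clopen algebras. -/
def clopenComap {X₁ X₂ : Type u} [TopologicalSpace X₁] [TopologicalSpace X₂] (f : X₁ → X₂)
    (hf : PreservesClopen f) : BoundedLatticeHom (Clopens X₂) (Clopens X₁) where
  toFun U := ⟨f ⁻¹' U, hf U U.isClopen⟩
  map_sup' _ _ := rfl
  map_inf' _ _ := rfl
  map_top' := rfl
  map_bot' := rfl

/-- The PSI-algebra of clopen sets of `X`, given that it is one. -/
def clopenAlg (X : Space.{u}) (hX : IsPSIAlgebra (Clopens X) X.dia) : Alg.{u} :=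
  ⟨Clopens X, X.dia, hX⟩

/-- The assignment `(X, R) ↦ (CO(X), ◇_R)`, `f ↦ f⁻¹`, as a functor, given that it is well
defined on objects (`hobj`) and on morphisms (`hmap`). -/
def clopenFunctor (j : Kind)
    (hobj : ∀ X : Space.{u}, IsPSIAlgebra (Clopens X) X.dia)
    (hmap : ∀ (X Y : Space.{u}) (f : X → Y) (hf : IsSpMor j X.rel Y.rel f),
      IsAlgMor (A := clopenAlg Y (hobj Y)) (B := clopenAlg X (hobj X)) j
        (clopenComap f (isSpMor_preservesClopen hf))) :
    SpCat.{u} j ⥤ (AlgCat.{u} j)ᵒᵖ where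
  obj X := op ⟨clopenAlg X.space (hobj X.space)⟩
  map f := Quiver.Hom.op
    ⟨clopenComap f.map (isSpMor_preservesClopen f.isMor), hmap _ _ _ f.isMor⟩
  map_id _ := rfl
  map_comp _ _ := rfl

end PSI

/-!
A relation satisfying the second frame axiom is determined by the operator it induces on clopen
sets: for nonempty closed `Y`, `(x, Y) ∈ R` iff `x ∈ ◇_R(U)` for every triple `U ⊇ Y` of clopen
sets, and for clopen `U`, `x ∈ ◇_R(U)` iff `(x, U) ∈ R`. Under Stone duality a relation and its
operator therefore carry the same information, and each axiom on one side is a translation of an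
axiom on the other. Two of these translations need an idea. That `◇` preserves joins in its first
argument implies that the elements `a` with `◇(a, b, c) ∉ U` for some `b ∈ F_{Y₂}`, `c ∈ F_{Y₃}`
form an ideal; by compactness some point of `Y₁` avoids it, and together with the same argument
for `Y₂` this is the third frame axiom. The first PSI axiom for relations speaks of nonempty `Z`
and `W` only, and has to be extended to empty ones before it can be read off on clopen sets.

The Stone map and the map sending a point to its clopen neighbourhoods preserve and reflect all
the structure, so they are isomorphisms for all three kinds of morphisms at once.
-/

namespace PSI

/-! ### Stone spaces of Boolean algebras -/

section StoneSpace

variable {A : Type u} [BooleanAlgebra A]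

theorem Ult.compl_mem_iff (U : Ult A) {a : A} : aᶜ ∈ U.carrier ↔ a ∉ U.carrier := by
  refine ⟨fun hac ha => U.bot_notMem ?_, (U.mem_or_compl_mem a).resolve_left⟩
  simpa only [inf_compl_eq_bot] using U.inf_mem _ _ ha hac

theorem Ult.inf_mem_iff (U : Ult A) {a b : A} :
    a ⊓ b ∈ U.carrier ↔ a ∈ U.carrier ∧ b ∈ U.carrier :=
  ⟨fun h => ⟨U.mem_of_le _ _ h inf_le_left, U.mem_of_le _ _ h inf_le_right⟩,
    fun h => U.inf_mem _ _ h.1 h.2⟩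

theorem Ult.sup_mem_iff (U : Ult A) {a b : A} :
    a ⊔ b ∈ U.carrier ↔ a ∈ U.carrier ∨ b ∈ U.carrier := by
  rw [← not_iff_not, ← U.compl_mem_iff, compl_sup, U.inf_mem_iff, U.compl_mem_iff,
    U.compl_mem_iff, not_or]

theorem Ult.eq_of_subset {U V : Ult A} (h : U.carrier ⊆ V.carrier) : U = V := by
  refine Ult.ext (h.antisymm fun a haV => ?_)
  by_contra haU
  exact V.compl_mem_iff.1 (h (U.compl_mem_iff.2 haU)) haV

/-- The complement of a prime ideal, as an ultrafilter. -/
def Ult.ofPrimeIdeal (J : Order.Ideal A) (hJ : J.IsPrime) : Ult A where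
  carrier := {a | a ∉ J}
  top_mem := hJ.toIsProper.top_notMem
  bot_notMem h := h J.bot_mem
  inf_mem _ _ ha hb hab := (hJ.mem_or_mem hab).elim ha hb
  mem_of_le _ _ ha hab hb := ha (J.lower hab hb)
  mem_or_compl_mem _ :=
    or_iff_not_imp_left.2 fun ha hac => hJ.toIsProper.notMem_of_compl_mem hac (not_not.1 ha)

theorem stone_compl (a : A) : stone aᶜ = (stone a)ᶜ := Set.ext fun U => U.compl_mem_iff

theorem stone_inf (a b : A) : stone (a ⊓ b) = stone a ∩ stone b :=
  Set.ext fun U => U.inf_mem_iff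

theorem stone_sup (a b : A) : stone (a ⊔ b) = stone a ∪ stone b :=
  Set.ext fun U => U.sup_mem_iff

theorem stone_top : stone (⊤ : A) = Set.univ := Set.eq_univ_of_forall Ult.top_mem

theorem stone_bot : stone (⊥ : A) = ∅ := Set.eq_empty_of_forall_notMem Ult.bot_notMem

theorem stone_subset_iff {a b : A} : stone a ⊆ stone b ↔ a ≤ b := by
  refine ⟨fun h => ?_, fun hab U ha => U.mem_of_le _ _ ha hab⟩
  by_contra hab
  have hdisj : Disjoint (Order.PFilter.principal a : Set A) (Order.Ideal.principal b) :=
    Set.disjoint_left.2 fun x hax hxb => hab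
      ((Order.PFilter.mem_principal.1 hax).trans (Order.Ideal.mem_principal.1 hxb))
  obtain ⟨J, hJ, hbJ, haJ⟩ := DistribLattice.prime_ideal_of_disjoint_filter_ideal hdisj
  have ha : Ult.ofPrimeIdeal J hJ ∈ stone a :=
    Set.disjoint_left.1 haJ (Order.PFilter.mem_principal.2 le_rfl)
  exact h ha (hbJ Order.Ideal.mem_principal_self)

theorem stone_nonempty_iff {a : A} : (stone a).Nonempty ↔ a ≠ ⊥ := by
  rw [Set.nonempty_iff_ne_empty, ne_eq, ← Set.subset_empty_iff, ← stone_bot, stone_subset_iff,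
    le_bot_iff]

theorem isOpen_stone (a : A) : IsOpen (stone a) := isOpen_generateFrom_of_mem ⟨a, rfl⟩

theorem isClopen_stone (a : A) : IsClopen (stone a) :=
  ⟨isOpen_compl_iff.1 (stone_compl a ▸ isOpen_stone aᶜ), isOpen_stone a⟩

theorem isTopologicalBasis_stone : IsTopologicalBasis (Set.range (stone (A := A))) where
  exists_subset_inter := by
    rintro _ ⟨a, rfl⟩ _ ⟨b, rfl⟩ U hU
    exact ⟨_, ⟨a ⊓ b, rfl⟩, stone_inf a b ▸ hU, (stone_inf a b).subset⟩
  sUnion_eq := Set.eq_univ_of_forall fun U => ⟨_, ⟨⊤, rfl⟩, U.top_mem⟩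
  eq_generateFrom := rfl

instance : TotallySeparatedSpace (Ult A) := by
  rw [totallySeparatedSpace_iff_exists_isClopen]
  intro U V hUV
  obtain ⟨a, haU, haV⟩ := Set.not_subset.1 fun h => hUV (Ult.eq_of_subset h)
  exact ⟨stone a, isClopen_stone a, haU, haV⟩

/-- The limit of an ultrafilter on the space of ultrafilters of `A`. -/
def Ult.lim (F : Ultrafilter (Ult A)) : Ult A where
  carrier := {a | stone a ∈ F}
  top_mem := by
    rw [Set.mem_ofPred_eq, stone_top]
    exact Filter.univ_mem
  bot_notMem := by
    rw [Set.mem_ofPred_eq, stone_bot]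
    exact F.empty_notMem
  inf_mem a b ha hb := by
    rw [Set.mem_ofPred_eq, stone_inf]
    exact Filter.inter_mem ha hb
  mem_of_le _ _ ha hab := Filter.mem_of_superset ha (stone_subset_iff.2 hab)
  mem_or_compl_mem a := by
    simpa only [Set.mem_ofPred_eq, stone_compl] using F.mem_or_compl_mem (stone a)

instance : CompactSpace (Ult A) := by
  refine ⟨isCompact_iff_ultrafilter_le_nhds.2 fun F _ => ⟨Ult.lim F, trivial, ?_⟩⟩
  rw [nhds_generateFrom]
  refine le_iInf₂ ?_
  rintro _ ⟨ha, a, rfl⟩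
  exact Filter.le_principal_iff.2 ha

theorem exists_mem_subset_stone_of_directedOn {K : Set (Ult A)} (hK : IsCompact K) {I : Set A}
    (hne : I.Nonempty) (hdir : DirectedOn (· ≤ ·) I)
    (hcover : ∀ y ∈ K, ∃ a ∈ I, a ∈ y.carrier) : ∃ a ∈ I, K ⊆ stone a := by
  have : Nonempty I := hne.to_subtype
  obtain ⟨⟨a, ha⟩, hKa⟩ := hK.elim_directed_cover (fun a : I => stone (a : A))
    (fun a => isOpen_stone _)
    (fun y hy => by
      obtain ⟨a, ha, hay⟩ := hcover y hy
      exact Set.mem_iUnion.2 ⟨⟨a, ha⟩, hay⟩)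
    (hdir.directed_val.mono_comp (· ≤ ·) (g := stone) (rb := (· ⊆ ·))
      fun _ _ => stone_subset_iff.2)
  exact ⟨a, ha, hKa⟩

theorem exists_stone_between {K O : Set (Ult A)} (hK : IsCompact K) (hO : IsOpen O)
    (hKO : K ⊆ O) : ∃ a, K ⊆ stone a ∧ stone a ⊆ O := by
  have hdir : DirectedOn (· ≤ ·) {a : A | stone a ⊆ O} := directedOn_of_sup_mem fun a b ha hb => by
    simpa only [Set.mem_ofPred_eq, stone_sup] using Set.union_subset ha hb
  obtain ⟨a, haO, hKa⟩ := exists_mem_subset_stone_of_directedOn hK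
    ⟨⊥, stone_bot.trans_subset (Set.empty_subset O)⟩ hdir fun y hy => by
      obtain ⟨_, ⟨a, rfl⟩, hya, haO⟩ :=
        isTopologicalBasis_stone.exists_subset_of_mem_open (hKO hy) hO
      exact ⟨a, haO, hya⟩
  exact ⟨a, hKa, haO⟩

theorem exists_stone_eq {V : Set (Ult A)} (hV : IsClopen V) : ∃ a, stone a = V := by
  obtain ⟨a, hVa, haV⟩ := exists_stone_between hV.1.isCompact hV.2 subset_rfl
  exact ⟨a, haV.antisymm hVa⟩

/-- The Stone map as an isomorphism of `A` onto the clopen algebra of its Stone space. -/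
noncomputable def stoneIso (A : Type u) [BooleanAlgebra A] : A ≃o Clopens (Ult A) :=
  RelIso.ofSurjective
    (OrderEmbedding.ofMapLEIff (fun a => (⟨stone a, isClopen_stone a⟩ : Clopens (Ult A)))
      fun _ _ => stone_subset_iff)
    fun V => (exists_stone_eq V.isClopen).imp fun _ => Clopens.ext

theorem mem_filterOf {Y : Set (Ult A)} {a : A} : a ∈ filterOf Y ↔ Y ⊆ stone a := Iff.rfl

theorem mem_filterOf_stone {a b : A} : b ∈ filterOf (stone a) ↔ a ≤ b := stone_subset_iff

theorem top_mem_filterOf (Y : Set (Ult A)) : ⊤ ∈ filterOf Y :=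
  (Set.subset_univ Y).trans_eq stone_top.symm

theorem bot_mem_filterOf_iff {Y : Set (Ult A)} : ⊥ ∈ filterOf Y ↔ Y = ∅ := by
  rw [mem_filterOf, stone_bot, Set.subset_empty_iff]

theorem inf_mem_filterOf {Y : Set (Ult A)} {a b : A} (ha : a ∈ filterOf Y)
    (hb : b ∈ filterOf Y) : a ⊓ b ∈ filterOf Y :=
  (Set.subset_inter ha hb).trans_eq (stone_inf a b).symm

theorem filterOf_anti {Y Z : Set (Ult A)} (h : Y ⊆ Z) : filterOf Z ⊆ filterOf Y :=
  fun _ ha => h.trans ha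

end StoneSpace

/-! ### Points of Boolean spaces as ultrafilters -/

section Points

variable {X : Type u} [TopologicalSpace X]

/-- The ultrafilter of clopen neighbourhoods of a point. -/
def clopenNhds (x : X) : Ult (Clopens X) where
  carrier := {U | x ∈ U}
  top_mem := trivial
  bot_notMem := id
  inf_mem _ _ ha hb := ⟨ha, hb⟩
  mem_of_le _ _ ha hab := hab ha
  mem_or_compl_mem U := em (x ∈ U)

theorem continuous_clopenNhds : Continuous (clopenNhds (X := X)) :=
  continuous_generateFrom_iff.2 (by rintro _ ⟨U, rfl⟩; exact U.isOpen)

theorem denseRange_clopenNhds : DenseRange (clopenNhds (X := X)) := by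
  refine isTopologicalBasis_stone.dense_iff.2 ?_
  rintro _ ⟨U, rfl⟩ hU
  obtain ⟨x, hx⟩ : (U : Set X).Nonempty := by
    rw [Set.nonempty_iff_ne_empty]
    exact fun h => stone_nonempty_iff.1 hU (Clopens.ext h)
  exact ⟨clopenNhds x, hx, x, rfl⟩

theorem clopenNhds_surjective [CompactSpace X] : Function.Surjective (clopenNhds (X := X)) := by
  rw [← Set.range_eq_univ, ← (isCompact_range continuous_clopenNhds).isClosed.closure_eq]
  exact denseRange_clopenNhds.closure_range

theorem clopenNhds_injective [TotallySeparatedSpace X] :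
    Function.Injective (clopenNhds (X := X)) := by
  intro x y hxy
  by_contra hne
  obtain ⟨U, hU, hxU, hyU⟩ := exists_isClopen_of_totally_separated hne
  have hUy : (⟨U, hU⟩ : Clopens X) ∈ (clopenNhds y).carrier := hxy ▸ hxU
  exact hyU hUy

/-- A Boolean space is homeomorphic to the Stone space of its clopen algebra. -/
noncomputable def clopenNhdsHomeo (X : Type u) [TopologicalSpace X] [CompactSpace X]
    [TotallySeparatedSpace X] : X ≃ₜ Ult (Clopens X) :=
  Continuous.homeoOfEquivCompactToT2
    (f := Equiv.ofBijective clopenNhds ⟨clopenNhds_injective, clopenNhds_surjective⟩)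
    continuous_clopenNhds

theorem mem_filterOf_image_clopenNhds {Y : Set X} {U : Clopens X} :
    U ∈ filterOf (clopenNhds '' Y) ↔ Y ⊆ U :=
  Set.image_subset_iff

end Points

/-! ### The space of a PSI-algebra -/

section Operators

variable {A : Type u} [BooleanAlgebra A] {dia : A → A → A → A}

namespace Is3BAMO

theorem mono (h : Is3BAMO A dia) {a a' b b' c c' : A} (ha : a ≤ a') (hb : b ≤ b')
    (hc : c ≤ c') : dia a b c ≤ dia a' b' c' :=
  calc
    dia a b c ≤ dia a' b c := by
      rw [← sup_eq_right.2 ha, h.sup_left]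
      exact le_sup_left
    _ ≤ dia a' b' c := by
      rw [← sup_eq_right.2 hb, h.sup_mid]
      exact le_sup_left
    _ ≤ dia a' b' c ⊔ dia a' b' c' := le_sup_left
    _ ≤ dia a' b' c' := (h.le_sup_right a' b' c c').trans_eq (by rw [sup_eq_right.2 hc])

theorem swap (h : Is3BAMO A dia) : Is3BAMO A fun a b c => dia b a c where
  bot_left b := h.bot_mid b
  bot_mid a := h.bot_left a
  bot_right a b := h.bot_right b a
  sup_left a x b := h.sup_mid b a x
  sup_mid a b x := h.sup_left b x a
  le_sup_right a b := h.le_sup_right b a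

theorem ne_bot (h : Is3BAMO A dia) {a b c : A} (hd : dia a b c ≠ ⊥) :
    a ≠ ⊥ ∧ b ≠ ⊥ ∧ c ≠ ⊥ := by
  refine ⟨?_, ?_, ?_⟩ <;> rintro rfl
  exacts [hd (h.bot_left b c), hd (h.bot_mid a c), hd (h.bot_right a b)]

end Is3BAMO

variable {U : Ult A} {Y₁ Y₂ Y₃ : Set (Ult A)}

theorem ultRel_iff (h : Is3BAMO A dia) (h₁ : IsClosed Y₁) (h₂ : IsClosed Y₂)
    (h₃ : IsClosed Y₃) : ultRel dia U Y₁ Y₂ Y₃ ↔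
      ∀ a ∈ filterOf Y₁, ∀ b ∈ filterOf Y₂, ∀ c ∈ filterOf Y₃, dia a b c ∈ U.carrier := by
  refine ⟨fun hY => hY.2.2.2, fun hF => ?_⟩
  have hne : ∀ a ∈ filterOf Y₁, ∀ b ∈ filterOf Y₂, ∀ c ∈ filterOf Y₃, a ≠ ⊥ ∧ b ≠ ⊥ ∧ c ≠ ⊥ :=
    fun a ha b hb c hc => h.ne_bot fun hbot => U.bot_notMem (hbot ▸ hF a ha b hb c hc)
  have t₁ := top_mem_filterOf Y₁
  have t₂ := top_mem_filterOf Y₂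
  have t₃ := top_mem_filterOf Y₃
  refine ⟨⟨h₁, Set.nonempty_iff_ne_empty.2 fun he => ?_⟩,
    ⟨h₂, Set.nonempty_iff_ne_empty.2 fun he => ?_⟩,
    ⟨h₃, Set.nonempty_iff_ne_empty.2 fun he => ?_⟩, hF⟩
  · exact (hne ⊥ (bot_mem_filterOf_iff.2 he) ⊤ t₂ ⊤ t₃).1 rfl
  · exact (hne ⊤ t₁ ⊥ (bot_mem_filterOf_iff.2 he) ⊤ t₃).2.1 rfl
  · exact (hne ⊤ t₁ ⊤ t₂ ⊥ (bot_mem_filterOf_iff.2 he)).2.2 rfl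

theorem ultRel_stone_iff (h : Is3BAMO A dia) {a b c : A} :
    ultRel dia U (stone a) (stone b) (stone c) ↔ dia a b c ∈ U.carrier := by
  rw [ultRel_iff h (isClopen_stone a).1 (isClopen_stone b).1 (isClopen_stone c).1]
  simp only [mem_filterOf_stone]
  exact ⟨fun hF => hF a le_rfl b le_rfl c le_rfl,
    fun hU a' ha b' hb c' hc => U.mem_of_le _ _ hU (h.mono ha hb hc)⟩

theorem ultRel.mono (hY : ultRel dia U Y₁ Y₂ Y₃) {Z₁ Z₂ Z₃ : Set (Ult A)} (hZ₁ : IsClosed Z₁)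
    (hZ₂ : IsClosed Z₂) (hZ₃ : IsClosed Z₃) (h₁ : Y₁ ⊆ Z₁) (h₂ : Y₂ ⊆ Z₂) (h₃ : Y₃ ⊆ Z₃) :
    ultRel dia U Z₁ Z₂ Z₃ :=
  ⟨⟨hZ₁, hY.1.2.mono h₁⟩, ⟨hZ₂, hY.2.1.2.mono h₂⟩, ⟨hZ₃, hY.2.2.1.2.mono h₃⟩,
    fun a ha b hb c hc => hY.2.2.2 a (filterOf_anti h₁ ha) b (filterOf_anti h₂ hb)
      c (filterOf_anti h₃ hc)⟩

theorem ultRel_swap_iff :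
    ultRel (fun a b c => dia b a c) U Y₂ Y₁ Y₃ ↔ ultRel dia U Y₁ Y₂ Y₃ :=
  ⟨fun ⟨h₂, h₁, h₃, hF⟩ => ⟨h₁, h₂, h₃, fun a ha b hb => hF b hb a ha⟩,
    fun ⟨h₁, h₂, h₃, hF⟩ => ⟨h₂, h₁, h₃, fun b hb a ha => hF a ha b hb⟩⟩

theorem ultRel.exists_singleton_left (h : Is3BAMO A dia) (hY : ultRel dia U Y₁ Y₂ Y₃) :
    ∃ y ∈ Y₁, ultRel dia U {y} Y₂ Y₃ := by
  obtain ⟨h₁, h₂, h₃, hF⟩ := hY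
  let I : Set A := {a | ∃ b ∈ filterOf Y₂, ∃ c ∈ filterOf Y₃, dia a b c ∉ U.carrier}
  have hbot : ⊥ ∈ I := by
    refine ⟨⊤, top_mem_filterOf Y₂, ⊤, top_mem_filterOf Y₃, ?_⟩
    rw [h.bot_left]
    exact U.bot_notMem
  have hsup : ∀ a a', a ∈ I → a' ∈ I → a ⊔ a' ∈ I := by
    rintro a a' ⟨b, hb, c, hc, ha⟩ ⟨b', hb', c', hc', ha'⟩
    refine ⟨b ⊓ b', inf_mem_filterOf hb hb', c ⊓ c', inf_mem_filterOf hc hc', ?_⟩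
    rw [h.sup_left, U.sup_mem_iff, not_or]
    exact ⟨fun hm => ha (U.mem_of_le _ _ hm (h.mono le_rfl inf_le_left inf_le_left)),
      fun hm => ha' (U.mem_of_le _ _ hm (h.mono le_rfl inf_le_right inf_le_right))⟩
  by_contra! hn
  have hcover : ∀ y ∈ Y₁, ∃ a ∈ I, a ∈ y.carrier := by
    intro y hy
    have hny := hn y hy
    rw [ultRel_iff h isClosed_singleton h₂.1 h₃.1] at hny
    push Not at hny
    obtain ⟨a, ha, hI⟩ := hny
    exact ⟨a, hI, ha rfl⟩
  obtain ⟨a, ⟨b, hb, c, hc, hnU⟩, hYa⟩ := exists_mem_subset_stone_of_directedOn h₁.1.isCompact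
    ⟨⊥, hbot⟩ (directedOn_of_sup_mem fun {a a'} => hsup a a') hcover
  exact hnU (hF a hYa b hb c hc)

theorem ultRel.exists_singletons (h : Is3BAMO A dia) (hY : ultRel dia U Y₁ Y₂ Y₃) :
    ∃ y₁ ∈ Y₁, ∃ y₂ ∈ Y₂, ultRel dia U {y₁} {y₂} Y₃ := by
  obtain ⟨y₁, hy₁, hY'⟩ := hY.exists_singleton_left h
  obtain ⟨y₂, hy₂, hY''⟩ := (ultRel_swap_iff.2 hY').exists_singleton_left h.swap
  exact ⟨y₁, hy₁, y₂, hy₂, ultRel_swap_iff.1 hY''⟩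

theorem ultRel.or_or_closure_compl (h : Is3BAMO A dia)
    (hpi1 : ∀ a b d e f, dia a b f ≤ dia a b dᶜ ⊔ dia a b eᶜ ⊔ dia d e f)
    (hY : ultRel dia U Y₁ Y₂ Y₃) {Z W : Set (Ult A)} (hZ : IsClosed Z) (hW : IsClosed W) :
    (ultRel dia U Y₁ Y₂ Z ∨ ultRel dia U Y₁ Y₂ W) ∨
      ultRel dia U (closure Zᶜ) (closure Wᶜ) Y₃ := by
  obtain ⟨h₁, h₂, h₃, hF⟩ := hY
  refine or_iff_not_imp_left.2 fun hn => ?_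
  rw [ultRel_iff h h₁.1 h₂.1 hZ, ultRel_iff h h₁.1 h₂.1 hW] at hn
  push Not at hn
  obtain ⟨⟨a, ha, b, hb, d, hd, hnd⟩, a', ha', b', hb', e, he, hne⟩ := hn
  have hmem : ∀ c ∈ filterOf Y₃, dia dᶜ eᶜ c ∈ U.carrier := by
    intro c hc
    have hm := U.mem_of_le _ _ (hF (a ⊓ a') (inf_mem_filterOf ha ha') (b ⊓ b')
      (inf_mem_filterOf hb hb') c hc) (hpi1 _ _ dᶜ eᶜ c)
    simp only [U.sup_mem_iff, compl_compl] at hm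
    rcases hm with (hm | hm) | hm
    · exact absurd (U.mem_of_le _ _ hm (h.mono inf_le_left inf_le_left le_rfl)) hnd
    · exact absurd (U.mem_of_le _ _ hm (h.mono inf_le_right inf_le_right le_rfl)) hne
    · exact hm
  have hstone : ultRel dia U (stone dᶜ) (stone eᶜ) Y₃ :=
    (ultRel_iff h (isClopen_stone _).1 (isClopen_stone _).1 h₃.1).2 fun p hp q hq c hc =>
      U.mem_of_le _ _ (hmem c hc)
        (h.mono (mem_filterOf_stone.1 hp) (mem_filterOf_stone.1 hq) le_rfl)
  have hsub : ∀ {V : Set (Ult A)} {v : A}, v ∈ filterOf V → stone vᶜ ⊆ closure Vᶜ := by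
    intro V v hv
    rw [stone_compl]
    exact (Set.compl_subset_compl.2 hv).trans subset_closure
  exact hstone.mono isClosed_closure isClosed_closure h₃.1 (hsub hd) (hsub he) subset_rfl

theorem ultRel.inter_nonempty (hpi2 : ∀ a b, dia a b aᶜ = ⊥) (hY : ultRel dia U Y₁ Y₂ Y₃) :
    (Y₁ ∩ Y₃).Nonempty := by
  obtain ⟨h₁, -, h₃, hF⟩ := hY
  by_contra hdisj
  rw [Set.not_nonempty_iff_eq_empty, ← Set.disjoint_iff_inter_eq_empty] at hdisj
  obtain ⟨a, ha, haY₃⟩ :=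
    exists_stone_between h₁.1.isCompact h₃.1.isOpen_compl hdisj.subset_compl_right
  have hac : aᶜ ∈ filterOf Y₃ := by
    rw [mem_filterOf, stone_compl]
    exact Set.subset_compl_comm.1 haY₃
  exact U.bot_notMem (hpi2 a ⊤ ▸ hF a ha ⊤ (top_mem_filterOf Y₂) aᶜ hac)

theorem ultRel_self_of_mem_inter (h : Is3BAMO A dia) (hpi3 : ∀ a f, a ⊓ f ≤ dia a a f)
    (h₁ : IsClosed Y₁) (h₂ : IsClosed Y₂) (hU : U ∈ Y₁ ∩ Y₂) : ultRel dia U Y₁ Y₁ Y₂ :=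
  (ultRel_iff h h₁ h₁ h₂).2 fun _ ha _ hb _ hc =>
    U.mem_of_le _ _ (U.inf_mem _ _ (U.inf_mem _ _ (ha hU.1) (hb hU.1)) (hc hU.2))
      ((hpi3 _ _).trans (h.mono inf_le_left inf_le_right le_rfl))

theorem ultRel.symm (hpi4 : ∀ a b f, dia a b f ≤ dia b a f) (hY : ultRel dia U Y₁ Y₂ Y₃) :
    ultRel dia U Y₂ Y₁ Y₃ :=
  ⟨hY.2.1, hY.1, hY.2.2.1, fun b hb a ha c hc =>
    U.mem_of_le _ _ (hY.2.2.2 a ha b hb c hc) (hpi4 a b c)⟩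

end Operators

section Relations

variable {X : Type u} {R : X → Set X → Set X → Set X → Prop} {U₁ U₂ U₃ : Set X} {x : X}

theorem not_meets_compl_iff {Y₁ Y₂ Y₃ : Set X} :
    ¬ Meets Y₁ Y₂ Y₃ U₁ᶜ U₂ᶜ U₃ᶜ ↔ Y₁ ⊆ U₁ ∧ Y₂ ⊆ U₂ ∧ Y₃ ⊆ U₃ := by
  simp only [Meets, not_or, Set.inter_compl_nonempty_iff, not_not]

theorem mem_diaRel : x ∈ diaRel R U₁ U₂ U₃ ↔
    ∃ Y₁ Y₂ Y₃, R x Y₁ Y₂ Y₃ ∧ Y₁ ⊆ U₁ ∧ Y₂ ⊆ U₂ ∧ Y₃ ⊆ U₃ := by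
  simp only [diaRel, Set.mem_ofPred_eq, not_meets_compl_iff]

theorem mem_boxRel_compl : x ∈ boxRel R U₁ᶜ U₂ᶜ U₃ᶜ ↔ x ∉ diaRel R U₁ U₂ U₃ := by
  simp only [diaRel, boxRel, Set.mem_ofPred_eq, not_exists, not_and, not_not]

theorem diaRel_mono {V₁ V₂ V₃ : Set X} (h₁ : U₁ ⊆ V₁) (h₂ : U₂ ⊆ V₂) (h₃ : U₃ ⊆ V₃) :
    diaRel R U₁ U₂ U₃ ⊆ diaRel R V₁ V₂ V₃ := by
  intro x hx
  obtain ⟨Y₁, Y₂, Y₃, hY, k₁, k₂, k₃⟩ := mem_diaRel.1 hx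
  exact mem_diaRel.2 ⟨Y₁, Y₂, Y₃, hY, k₁.trans h₁, k₂.trans h₂, k₃.trans h₃⟩

end Relations

section UltFrame

variable {A : Type u} [BooleanAlgebra A] {dia : A → A → A → A}

theorem diaRel_ultRel_stone (h : Is3BAMO A dia) (a b c : A) :
    diaRel (ultRel dia) (stone a) (stone b) (stone c) = stone (dia a b c) := by
  ext U
  refine mem_diaRel.trans ⟨?_, fun hU =>
    ⟨_, _, _, (ultRel_stone_iff h).2 hU, subset_rfl, subset_rfl, subset_rfl⟩⟩
  rintro ⟨Y₁, Y₂, Y₃, hY, h₁, h₂, h₃⟩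
  exact hY.2.2.2 a h₁ b h₂ c h₃

theorem isPSIFrame_ult (h : Is3BAMO A dia) : IsPSIFrame (Ult A) (ultRel dia) where
  compact := inferInstance
  hausdorff := inferInstance
  totallyDisconnected := inferInstance
  rel_C0 _ _ _ _ hY := ⟨hY.1, hY.2.1, hY.2.2.1⟩
  df1 U₁ U₂ U₃ h₁ h₂ h₃ := by
    obtain ⟨a, rfl⟩ := exists_stone_eq h₁
    obtain ⟨b, rfl⟩ := exists_stone_eq h₂
    obtain ⟨c, rfl⟩ := exists_stone_eq h₃
    exact diaRel_ultRel_stone h a b c ▸ isClopen_stone _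
  df2 U Y₁ Y₂ Y₃ h₁ h₂ h₃ := by
    refine ⟨fun hR _ _ _ _ _ _ hbox => hbox _ _ _ hR, fun hR => ⟨h₁, h₂, h₃, ?_⟩⟩
    intro a ha b hb c hc
    by_contra hn
    have hbox : U ∈ boxRel (ultRel dia) (stone a)ᶜ (stone b)ᶜ (stone c)ᶜ :=
      mem_boxRel_compl.2 fun hU => hn ((diaRel_ultRel_stone h a b c).subset hU)
    exact not_meets_compl_iff.2 ⟨ha, hb, hc⟩ (hR _ _ _ (isClopen_stone a).compl
      (isClopen_stone b).compl (isClopen_stone c).compl hbox)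
  df3 _ _ _ _ hY := hY.exists_singletons h

theorem isPSISpace_ult (h : IsPSIAlgebra A dia) : IsPSISpace (Ult A) (ultRel dia) where
  toIsPSIFrame := isPSIFrame_ult h.toIs3BAMO
  pif1 _ _ _ _ _ _ _ _ hZ hW _ hY := hY.or_or_closure_compl h.toIs3BAMO h.pi1 hZ.1 hW.1
  pif2 _ _ _ _ _ _ hdisj := Set.eq_empty_of_forall_notMem fun _ hY =>
    (ultRel.inter_nonempty h.pi2 hY).ne_empty hdisj
  pif3 _ _ h₁ h₂ _ hU := ultRel_self_of_mem_inter h.toIs3BAMO h.pi3 h₁.1 h₂.1 hU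
  pif4 _ _ _ _ _ _ _ hY := ultRel.symm h.pi4 hY

end UltFrame

section UltMaps

variable {A B : Type u} [BooleanAlgebra A] [BooleanAlgebra B] (h : BoundedLatticeHom A B)

theorem continuous_comap : Continuous (Ult.comap h) :=
  continuous_generateFrom_iff.2 (by rintro _ ⟨a, rfl⟩; exact isOpen_stone (h a))

theorem preservesClopen_comap : PreservesClopen (Ult.comap h) :=
  fun _ hU => hU.preimage (continuous_comap h)

theorem mem_filterOf_image_comap {Y : Set (Ult B)} {a : A} :
    a ∈ filterOf (Ult.comap h '' Y) ↔ h a ∈ filterOf Y :=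
  Set.image_subset_iff

theorem exists_mem_filterOf_map_le {Z : Set (Ult A)} (hZ : IsClosed Z) {b : B}
    (hb : b ∈ filterOf (Ult.comap h ⁻¹' Z)) : ∃ a ∈ filterOf Z, h a ≤ b := by
  have hK : IsClosed (Ult.comap h '' (stone b)ᶜ) :=
    ((isClopen_stone b).compl.1.isCompact.image (continuous_comap h)).isClosed
  have hZK : Z ⊆ (Ult.comap h '' (stone b)ᶜ)ᶜ := by
    rintro _ hz ⟨y, hy, rfl⟩
    exact hy (hb hz)
  obtain ⟨a, hZa, haK⟩ := exists_stone_between hZ.isCompact hK.isOpen_compl hZK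
  refine ⟨a, hZa, stone_subset_iff.1 fun y hy => ?_⟩
  by_contra hyb
  exact haK hy ⟨y, hyb, rfl⟩

variable {dA : A → A → A → A} {dB : B → B → B → B}

theorem back_comap (hdB : Is3BAMO B dB)
    (hh : ∀ a b c, h (dA a b c) ≤ dB (h a) (h b) (h c)) :
    Back (ultRel dB) (ultRel dA) (Ult.comap h) := by
  rintro U Z₁ Z₂ Z₃ ⟨h₁, h₂, h₃, hF⟩
  have hclosed : ∀ {Z : Set (Ult A)}, C0 Z → IsClosed (Ult.comap h ⁻¹' Z) :=
    fun hZ => hZ.1.preimage (continuous_comap h)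
  refine ⟨_, _, _, (ultRel_iff hdB (hclosed h₁) (hclosed h₂) (hclosed h₃)).2 ?_,
    Set.image_preimage_subset _ _, Set.image_preimage_subset _ _, Set.image_preimage_subset _ _⟩
  intro b₁ hb₁ b₂ hb₂ b₃ hb₃
  obtain ⟨a₁, ha₁, hab₁⟩ := exists_mem_filterOf_map_le h h₁.1 hb₁
  obtain ⟨a₂, ha₂, hab₂⟩ := exists_mem_filterOf_map_le h h₂.1 hb₂
  obtain ⟨a₃, ha₃, hab₃⟩ := exists_mem_filterOf_map_le h h₃.1 hb₃
  exact U.mem_of_le _ _ (hF a₁ ha₁ a₂ ha₂ a₃ ha₃) ((hh _ _ _).trans (hdB.mono hab₁ hab₂ hab₃))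

theorem forth_comap (hh : ∀ a b c, dB (h a) (h b) (h c) ≤ h (dA a b c)) :
    Forth (ultRel dB) (ultRel dA) (Ult.comap h) := by
  rintro U Y₁ Y₂ Y₃ ⟨h₁, h₂, h₃, hF⟩
  have hC0 : ∀ {Y : Set (Ult B)}, C0 Y → C0 (Ult.comap h '' Y) := fun hY =>
    ⟨(hY.1.isCompact.image (continuous_comap h)).isClosed, hY.2.image _⟩
  refine ⟨hC0 h₁, hC0 h₂, hC0 h₃, fun a ha b hb c hc => ?_⟩
  rw [mem_filterOf_image_comap] at ha hb hc
  exact U.mem_of_le _ _ (hF (h a) ha (h b) hb (h c) hc) (hh a b c)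

end UltMaps

theorem isPSIHom_iff {A B : Alg.{u}} {h : BoundedLatticeHom A B} :
    IsPSIHom h ↔ IsSemiHom h ∧ IsHemiHom h :=
  ⟨fun hh => ⟨fun a b c => (hh a b c).le, fun a b c => (hh a b c).ge⟩,
    fun hh a b c => (hh.1 a b c).antisymm (hh.2 a b c)⟩

theorem IsPSIHom.isAlgMor {A B : Alg.{u}} {h : BoundedLatticeHom A B} (hh : IsPSIHom h)
    (j : Kind) : IsAlgMor j h := by
  cases j
  exacts [(isPSIHom_iff.1 hh).1, (isPSIHom_iff.1 hh).2, hh]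

theorem IsPSIMap.isSpMor {X₁ X₂ : Type u} [TopologicalSpace X₁] [TopologicalSpace X₂]
    {R₁ : X₁ → Set X₁ → Set X₁ → Set X₁ → Prop} {R₂ : X₂ → Set X₂ → Set X₂ → Set X₂ → Prop}
    {f : X₁ → X₂} (hf : IsPSIMap R₁ R₂ f) (j : Kind) : IsSpMor j R₁ R₂ f := by
  cases j
  exacts [hf.1, hf.2, hf]

theorem isSpMor_comap {j : Kind} (A B : Alg.{u}) (h : BoundedLatticeHom A B)
    (hh : IsAlgMor j h) : IsSpMor j (ultRel B.dia) (ultRel A.dia) (Ult.comap h) := by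
  have hsemi : IsSemiHom h → IsSemiMap (ultRel B.dia) (ultRel A.dia) (Ult.comap h) :=
    fun hs => ⟨preservesClopen_comap h, back_comap h B.isPSI.toIs3BAMO hs⟩
  have hhemi : IsHemiHom h → IsHemiMap (ultRel B.dia) (ultRel A.dia) (Ult.comap h) :=
    fun hs => ⟨preservesClopen_comap h, forth_comap h hs⟩
  cases j
  exacts [hsemi hh, hhemi hh, (isPSIHom_iff.1 hh).imp hsemi hhemi]

/-! ### The clopen algebra of a PSI-space -/

section Frames

variable {X : Type u} [TopologicalSpace X] {R : X → Set X → Set X → Set X → Prop} {x : X}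
  {Y₁ Y₂ Y₃ U₁ U₂ U₃ : Set X}

namespace IsPSIFrame

theorem rel_mono (h : IsPSIFrame X R) {Z₁ Z₂ Z₃ : Set X} (hY : R x Y₁ Y₂ Y₃)
    (hZ₁ : IsClosed Z₁) (hZ₂ : IsClosed Z₂) (hZ₃ : IsClosed Z₃)
    (h₁ : Y₁ ⊆ Z₁) (h₂ : Y₂ ⊆ Z₂) (h₃ : Y₃ ⊆ Z₃) : R x Z₁ Z₂ Z₃ := by
  obtain ⟨k₁, k₂, k₃⟩ := h.rel_C0 _ _ _ _ hY
  refine (h.df2 x Z₁ Z₂ Z₃ ⟨hZ₁, k₁.2.mono h₁⟩ ⟨hZ₂, k₂.2.mono h₂⟩ ⟨hZ₃, k₃.2.mono h₃⟩).2 ?_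
  intro U₁ U₂ U₃ _ _ _ hbox
  exact (hbox _ _ _ hY).imp (.mono (Set.inter_subset_inter_left _ h₁))
    (.imp (.mono (Set.inter_subset_inter_left _ h₂)) (.mono (Set.inter_subset_inter_left _ h₃)))

theorem mem_diaRel_iff (h : IsPSIFrame X R) (h₁ : IsClosed U₁) (h₂ : IsClosed U₂)
    (h₃ : IsClosed U₃) : x ∈ diaRel R U₁ U₂ U₃ ↔ R x U₁ U₂ U₃ := by
  refine mem_diaRel.trans ⟨?_, fun hR => ⟨_, _, _, hR, subset_rfl, subset_rfl, subset_rfl⟩⟩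
  rintro ⟨Y₁, Y₂, Y₃, hY, k₁, k₂, k₃⟩
  exact h.rel_mono hY h₁ h₂ h₃ k₁ k₂ k₃

theorem mem_diaRel_iff_exists_singletons (h : IsPSIFrame X R) :
    x ∈ diaRel R U₁ U₂ U₃ ↔ ∃ y₁ ∈ U₁, ∃ y₂ ∈ U₂, ∃ Y₃ ⊆ U₃, R x {y₁} {y₂} Y₃ := by
  rw [mem_diaRel]
  constructor
  · rintro ⟨Y₁, Y₂, Y₃, hY, h₁, h₂, h₃⟩
    obtain ⟨y₁, hy₁, y₂, hy₂, hR⟩ := h.df3 _ _ _ _ hY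
    exact ⟨y₁, h₁ hy₁, y₂, h₂ hy₂, Y₃, h₃, hR⟩
  · rintro ⟨y₁, hy₁, y₂, hy₂, Y₃, h₃, hR⟩
    exact ⟨_, _, _, hR, Set.singleton_subset_iff.2 hy₁, Set.singleton_subset_iff.2 hy₂, h₃⟩

theorem rel_iff_forall_isClopen (h : IsPSIFrame X R) (h₁ : C0 Y₁) (h₂ : C0 Y₂) (h₃ : C0 Y₃) :
    R x Y₁ Y₂ Y₃ ↔ ∀ U₁ U₂ U₃ : Set X, IsClopen U₁ → IsClopen U₂ → IsClopen U₃ →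
      Y₁ ⊆ U₁ → Y₂ ⊆ U₂ → Y₃ ⊆ U₃ → x ∈ diaRel R U₁ U₂ U₃ := by
  refine ⟨fun hR U₁ U₂ U₃ _ _ _ k₁ k₂ k₃ => mem_diaRel.2 ⟨_, _, _, hR, k₁, k₂, k₃⟩, fun hR => ?_⟩
  refine (h.df2 x _ _ _ h₁ h₂ h₃).2 fun U₁ U₂ U₃ c₁ c₂ c₃ hbox => ?_
  by_contra hn
  rw [← compl_compl U₁, ← compl_compl U₂, ← compl_compl U₃] at hn hbox
  obtain ⟨k₁, k₂, k₃⟩ := not_meets_compl_iff.1 hn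
  exact mem_boxRel_compl.1 hbox (hR _ _ _ c₁.compl c₂.compl c₃.compl k₁ k₂ k₃)

/-- The operator `◇_R` on the clopen algebra of a descriptive frame. -/
def dia (h : IsPSIFrame X R) (U₁ U₂ U₃ : Clopens X) : Clopens X :=
  ⟨diaRel R U₁ U₂ U₃, h.df1 _ _ _ U₁.isClopen U₂.isClopen U₃.isClopen⟩

theorem mem_dia (h : IsPSIFrame X R) {U₁ U₂ U₃ : Clopens X} :
    x ∈ h.dia U₁ U₂ U₃ ↔ R x U₁ U₂ U₃ :=
  h.mem_diaRel_iff U₁.isClosed U₂.isClosed U₃.isClosed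

theorem C0_of_mem_dia (h : IsPSIFrame X R) {U₁ U₂ U₃ : Clopens X} (hx : x ∈ h.dia U₁ U₂ U₃) :
    C0 (U₁ : Set X) ∧ C0 (U₂ : Set X) ∧ C0 (U₃ : Set X) :=
  h.rel_C0 _ _ _ _ (h.mem_dia.1 hx)

theorem is3BAMO_dia (h : IsPSIFrame X R) : Is3BAMO (Clopens X) h.dia where
  bot_left _ _ := le_bot_iff.1 fun _ hx => absurd (h.C0_of_mem_dia hx).1.2 Set.not_nonempty_empty
  bot_mid _ _ := le_bot_iff.1 fun _ hx => absurd (h.C0_of_mem_dia hx).2.1.2 Set.not_nonempty_empty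
  bot_right _ _ :=
    le_bot_iff.1 fun _ hx => absurd (h.C0_of_mem_dia hx).2.2.2 Set.not_nonempty_empty
  sup_left U V W T := by
    refine Clopens.ext (Set.ext fun x => h.mem_diaRel_iff_exists_singletons.trans ?_)
    simp only [Clopens.coe_sup, dia, Clopens.coe_mk, Set.mem_union,
      h.mem_diaRel_iff_exists_singletons, or_and_right, exists_or]
  sup_mid U V W T := by
    refine Clopens.ext (Set.ext fun x => h.mem_diaRel_iff_exists_singletons.trans ?_)
    simp only [Clopens.coe_sup, dia, Clopens.coe_mk, Set.mem_union,
      h.mem_diaRel_iff_exists_singletons, or_and_right, and_or_left, exists_or]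
  le_sup_right _ _ _ _ := sup_le (diaRel_mono subset_rfl subset_rfl Set.subset_union_left)
    (diaRel_mono subset_rfl subset_rfl Set.subset_union_right)

theorem ultRel_clopenNhds_iff (h : IsPSIFrame X R) :
    ultRel h.dia (clopenNhds x) (clopenNhds '' Y₁) (clopenNhds '' Y₂) (clopenNhds '' Y₃) ↔
      R x Y₁ Y₂ Y₃ := by
  have := h.compact
  have := h.hausdorff
  have := h.totallyDisconnected
  have hC0 : ∀ Y : Set X, C0 (clopenNhds '' Y) ↔ C0 Y := fun Y =>
    and_congr (clopenNhdsHomeo X).isClosed_image Set.image_nonempty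
  simp only [ultRel, hC0, mem_filterOf_image_clopenNhds]
  constructor
  · rintro ⟨h₁, h₂, h₃, hF⟩
    exact (h.rel_iff_forall_isClopen h₁ h₂ h₃).2 fun U₁ U₂ U₃ c₁ c₂ c₃ k₁ k₂ k₃ =>
      hF ⟨U₁, c₁⟩ k₁ ⟨U₂, c₂⟩ k₂ ⟨U₃, c₃⟩ k₃
  · intro hR
    obtain ⟨h₁, h₂, h₃⟩ := h.rel_C0 _ _ _ _ hR
    exact ⟨h₁, h₂, h₃, fun U₁ k₁ U₂ k₂ U₃ k₃ => (h.rel_iff_forall_isClopen h₁ h₂ h₃).1 hR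
      _ _ _ U₁.isClopen U₂.isClopen U₃.isClopen k₁ k₂ k₃⟩

end IsPSIFrame

namespace IsPSISpace

theorem rel_or_rel_or_rel_closure_compl (h : IsPSISpace X R) (hY : R x Y₁ Y₂ Y₃) {Z W : Set X}
    (hZ : IsClosed Z) (hW : IsClosed W) :
    (R x Y₁ Y₂ Z ∨ R x Y₁ Y₂ W) ∨ R x (closure Zᶜ) (closure Wᶜ) Y₃ := by
  obtain ⟨k₁, k₂, k₃⟩ := h.rel_C0 _ _ _ _ hY
  have enlarge : ∀ {Y Y' V V' : Set X}, R x Y Y' Y₃ → Y ⊆ closure V → Y' ⊆ closure V' →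
      R x (closure V) (closure V') Y₃ := fun hR hYV hYV' =>
    h.rel_mono hR isClosed_closure isClosed_closure k₃.1 hYV hYV' subset_rfl
  -- If exactly one of `Z`, `W` is empty, the axiom is applied to the other one twice.
  rcases Z.eq_empty_or_nonempty with rfl | hZn <;> rcases W.eq_empty_or_nonempty with rfl | hWn
  · exact .inr (enlarge hY (by simp) (by simp))
  · exact (h.pif1 _ _ _ W W k₁ k₂ k₃ ⟨hW, hWn⟩ ⟨hW, hWn⟩ hY).imp (fun hR => .inr (or_self_iff.1 hR))
      fun hR => enlarge hR (by simp) subset_rfl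
  · exact (h.pif1 _ _ _ Z Z k₁ k₂ k₃ ⟨hZ, hZn⟩ ⟨hZ, hZn⟩ hY).imp (fun hR => .inl (or_self_iff.1 hR))
      fun hR => enlarge hR subset_rfl (by simp)
  · exact h.pif1 _ _ _ Z W k₁ k₂ k₃ ⟨hZ, hZn⟩ ⟨hW, hWn⟩ hY

theorem isPSIAlgebra_dia (h : IsPSISpace X R) : IsPSIAlgebra (Clopens X) h.dia where
  toIs3BAMO := h.is3BAMO_dia
  pi1 U V D E W x hx := by
    have hDE := h.rel_or_rel_or_rel_closure_compl (h.mem_dia.1 hx) (Dᶜ).isClosed (Eᶜ).isClosed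
    simp only [Clopens.coe_compl, compl_compl, D.isClosed.closure_eq, E.isClosed.closure_eq]
      at hDE
    exact hDE.imp (Or.imp h.mem_dia.2 h.mem_dia.2) h.mem_dia.2
  pi2 U V := by
    refine le_bot_iff.1 fun x hx => ?_
    obtain ⟨h₁, h₂, h₃⟩ := h.C0_of_mem_dia hx
    exact (h.pif2 _ _ _ h₁ h₂ h₃ (Set.inter_compl_self (U : Set X))).subset (h.mem_dia.1 hx)
  pi3 U V x hx := h.mem_dia.2 (h.pif3 U V ⟨U.isClosed, x, hx.1⟩ ⟨V.isClosed, x, hx.2⟩ hx)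
  pi4 U V W x hx := by
    obtain ⟨h₁, h₂, h₃⟩ := h.C0_of_mem_dia hx
    exact h.mem_dia.2 (h.pif4 _ _ _ h₁ h₂ h₃ (h.mem_dia.1 hx))

end IsPSISpace

end Frames

section MapsOfFrames

variable {X₁ X₂ : Type u} {R₁ : X₁ → Set X₁ → Set X₁ → Set X₁ → Prop}
  {R₂ : X₂ → Set X₂ → Set X₂ → Set X₂ → Prop} {f : X₁ → X₂}

theorem Back.preimage_diaRel_subset (hf : Back R₁ R₂ f) (U₁ U₂ U₃ : Set X₂) :
    f ⁻¹' diaRel R₂ U₁ U₂ U₃ ⊆ diaRel R₁ (f ⁻¹' U₁) (f ⁻¹' U₂) (f ⁻¹' U₃) := by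
  intro x hx
  obtain ⟨Z₁, Z₂, Z₃, hZ, h₁, h₂, h₃⟩ := mem_diaRel.1 hx
  obtain ⟨Y₁, Y₂, Y₃, hY, k₁, k₂, k₃⟩ := hf _ _ _ _ hZ
  exact mem_diaRel.2 ⟨Y₁, Y₂, Y₃, hY, Set.image_subset_iff.1 (k₁.trans h₁),
    Set.image_subset_iff.1 (k₂.trans h₂), Set.image_subset_iff.1 (k₃.trans h₃)⟩

theorem Forth.diaRel_preimage_subset (hf : Forth R₁ R₂ f) (U₁ U₂ U₃ : Set X₂) :
    diaRel R₁ (f ⁻¹' U₁) (f ⁻¹' U₂) (f ⁻¹' U₃) ⊆ f ⁻¹' diaRel R₂ U₁ U₂ U₃ := by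
  intro x hx
  obtain ⟨Y₁, Y₂, Y₃, hY, h₁, h₂, h₃⟩ := mem_diaRel.1 hx
  exact mem_diaRel.2 ⟨_, _, _, hf _ _ _ _ hY, Set.image_subset_iff.2 h₁,
    Set.image_subset_iff.2 h₂, Set.image_subset_iff.2 h₃⟩

end MapsOfFrames

theorem isPSIAlgebra_clopens (X : Space.{u}) : IsPSIAlgebra (Clopens X) X.dia :=
  X.isPSI.isPSIAlgebra_dia

/-- The space of ultrafilters of a PSI-algebra. -/
def Alg.dual (A : Alg.{u}) : Space.{u} := ⟨Ult A, ultRel A.dia, isPSISpace_ult A.isPSI⟩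

/-- The clopen algebra of a PSI-space. -/
def Space.dual (X : Space.{u}) : Alg.{u} := clopenAlg X (isPSIAlgebra_clopens X)

theorem isAlgMor_clopenComap {j : Kind} (X Y : Space.{u}) (f : X → Y)
    (hf : IsSpMor j X.rel Y.rel f) :
    IsAlgMor (A := Y.dual) (B := X.dual) j
      (clopenComap f (isSpMor_preservesClopen hf)) := by
  have hf' := isSpMor_preservesClopen hf
  have hsemi (hb : Back X.rel Y.rel f) :
      IsSemiHom (A := Y.dual) (B := X.dual) (clopenComap f hf') :=
    fun (U V W : Clopens Y) => hb.preimage_diaRel_subset U V W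
  have hhemi (hb : Forth X.rel Y.rel f) :
      IsHemiHom (A := Y.dual) (B := X.dual) (clopenComap f hf') :=
    fun (U V W : Clopens Y) => hb.diaRel_preimage_subset U V W
  cases j
  exacts [hsemi hf.2, hhemi hf.2, isPSIHom_iff.2 ⟨hsemi hf.1.2, hhemi hf.2.2⟩]

/-! ### The dual equivalence -/

section Isomorphisms

theorem isPSIHom_symm {A B : Alg.{u}} (e : A ≃o B) (he : IsPSIHom (e : BoundedLatticeHom A B)) :
    IsPSIHom (e.symm : BoundedLatticeHom B A) := by
  intro a b c
  have he' : e (A.dia (e.symm a) (e.symm b) (e.symm c)) = B.dia a b c := by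
    simpa using he (e.symm a) (e.symm b) (e.symm c)
  exact e.symm_apply_eq.2 he'.symm

/-- An order isomorphism commuting with the operators, as an isomorphism of PSI-algebras with
respect to the morphisms of kind `j`. -/
def Alg.isoOfOrderIso (j : Kind) {A B : Alg.{u}} (e : A ≃o B)
    (he : IsPSIHom (e : BoundedLatticeHom A B)) : (⟨A⟩ : AlgCat.{u} j) ≅ ⟨B⟩ where
  hom := ⟨(e : BoundedLatticeHom A B), he.isAlgMor j⟩
  inv := ⟨(e.symm : BoundedLatticeHom B A), (isPSIHom_symm e he).isAlgMor j⟩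
  hom_inv_id := AlgMor.ext (DFunLike.ext _ _ e.symm_apply_apply)
  inv_hom_id := AlgMor.ext (DFunLike.ext _ _ e.apply_symm_apply)

theorem isPSIMap_homeomorph {X₁ X₂ : Type u} [TopologicalSpace X₁] [TopologicalSpace X₂]
    {R₁ : X₁ → Set X₁ → Set X₁ → Set X₁ → Prop} {R₂ : X₂ → Set X₂ → Set X₂ → Set X₂ → Prop}
    (e : X₁ ≃ₜ X₂)
    (he : ∀ x Y₁ Y₂ Y₃, R₂ (e x) (e '' Y₁) (e '' Y₂) (e '' Y₃) ↔ R₁ x Y₁ Y₂ Y₃) :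
    IsPSIMap R₁ R₂ e := by
  have hclopen : PreservesClopen e := fun U hU => hU.preimage e.continuous
  have hback : Back R₁ R₂ e := fun x Z₁ Z₂ Z₃ hZ => by
    refine ⟨e ⁻¹' Z₁, e ⁻¹' Z₂, e ⁻¹' Z₃, (he _ _ _ _).1 ?_, Set.image_preimage_subset _ _,
      Set.image_preimage_subset _ _, Set.image_preimage_subset _ _⟩
    simpa only [e.image_preimage] using hZ
  exact ⟨⟨hclopen, hback⟩, hclopen, fun x Y₁ Y₂ Y₃ => (he x Y₁ Y₂ Y₃).2⟩

/-- A homeomorphism preserving and reflecting the relations, as an isomorphism of PSI-spaces with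
respect to the maps of kind `j`. -/
def Space.isoOfHomeomorph (j : Kind) {X Y : Space.{u}} (e : X ≃ₜ Y)
    (he : ∀ x Y₁ Y₂ Y₃, Y.rel (e x) (e '' Y₁) (e '' Y₂) (e '' Y₃) ↔ X.rel x Y₁ Y₂ Y₃) :
    (⟨X⟩ : SpCat.{u} j) ≅ ⟨Y⟩ where
  hom := ⟨e, (isPSIMap_homeomorph e he).isSpMor j⟩
  inv := ⟨e.symm, (isPSIMap_homeomorph e.symm fun y Z₁ Z₂ Z₃ => by
    rw [← he]
    simp only [e.apply_symm_apply, e.image_symm, e.image_preimage]).isSpMor j⟩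
  hom_inv_id := SpMor.ext (funext e.symm_apply_apply)
  inv_hom_id := SpMor.ext (funext e.apply_symm_apply)

end Isomorphisms

/-- A PSI-algebra is isomorphic to its double dual by the Stone map. -/
noncomputable def Alg.isoBidual (j : Kind) (A : Alg.{u}) :
    (⟨A⟩ : AlgCat.{u} j) ≅ ⟨A.dual.dual⟩ :=
  Alg.isoOfOrderIso j (B := A.dual.dual) (stoneIso A) fun a b c =>
    Clopens.ext (diaRel_ultRel_stone A.isPSI.toIs3BAMO a b c).symm

/-- A PSI-space is isomorphic to its double dual by the map sending a point to its clopen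
neighbourhoods. -/
noncomputable def Space.isoBidual (j : Kind) (X : Space.{u}) :
    (⟨X⟩ : SpCat.{u} j) ≅ ⟨X.dual.dual⟩ :=
  haveI := X.isPSI.compact
  haveI := X.isPSI.hausdorff
  haveI := X.isPSI.totallyDisconnected
  Space.isoOfHomeomorph j (Y := X.dual.dual) (clopenNhdsHomeo X) fun _ _ _ _ =>
    X.isPSI.ultRel_clopenNhds_iff

/-- The contravariant functor from PSI-algebras to PSI-spaces given by ultrafilters. -/
abbrev dualSpaceFunctor (j : Kind) : (AlgCat.{u} j)ᵒᵖ ⥤ SpCat.{u} j :=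
  ultFunctor j (fun A => isPSISpace_ult A.isPSI) isSpMor_comap

/-- The contravariant functor from PSI-spaces to PSI-algebras given by clopen sets. -/
abbrev dualAlgFunctor (j : Kind) : SpCat.{u} j ⥤ (AlgCat.{u} j)ᵒᵖ :=
  clopenFunctor j isPSIAlgebra_clopens isAlgMor_clopenComap

/-- The unit of the duality, with components the opposites of the inverse Stone maps. -/
noncomputable def unitNatIso (j : Kind) :
    𝟭 (AlgCat.{u} j)ᵒᵖ ≅ dualSpaceFunctor j ⋙ dualAlgFunctor j :=
  (NatIso.ofComponents (F := dualSpaceFunctor j ⋙ dualAlgFunctor j) (G := 𝟭 _)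
    (fun A => (A.unop.alg.isoBidual j).op)
    fun _ => Quiver.Hom.unop_inj (AlgMor.ext (DFunLike.ext _ _ fun _ => rfl))).symm

/-- The counit of the duality, with components inverse to the maps sending a point to its clopen
neighbourhoods. -/
noncomputable def counitNatIso (j : Kind) :
    dualAlgFunctor j ⋙ dualSpaceFunctor j ≅ 𝟭 (SpCat.{u} j) :=
  (NatIso.ofComponents (F := 𝟭 _) (G := dualAlgFunctor j ⋙ dualSpaceFunctor j)
    (fun X => X.space.isoBidual j)
    fun _ => SpMor.ext (funext fun _ => rfl)).symm

/-- The duality between PSI-algebras and PSI-spaces given by ultrafilters and clopen sets. -/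
noncomputable def dualEquivalence (j : Kind) : (AlgCat.{u} j)ᵒᵖ ≌ SpCat.{u} j :=
  CategoryTheory.Equivalence.mk (dualSpaceFunctor j) (dualAlgFunctor j) (unitNatIso j)
    (counitNatIso j)

end PSI

theorem mainTheorem9 (j : PSI.Kind) :
    ∃ (hG : ∀ A : PSI.Alg.{u}, PSI.IsPSISpace (PSI.Ult A) (PSI.ultRel A.dia))
      (hG' : ∀ (A B : PSI.Alg.{u}) (h : BoundedLatticeHom A B), PSI.IsAlgMor j h →
        PSI.IsSpMor j (PSI.ultRel B.dia) (PSI.ultRel A.dia) (PSI.Ult.comap h))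
      (hH : ∀ X : PSI.Space.{u}, PSI.IsPSIAlgebra (Clopens X) X.dia)
      (hH' : ∀ (X Y : PSI.Space.{u}) (f : X → Y) (hf : PSI.IsSpMor j X.rel Y.rel f),
        PSI.IsAlgMor (A := PSI.clopenAlg Y (hH Y)) (B := PSI.clopenAlg X (hH X)) j
          (PSI.clopenComap f (PSI.isSpMor_preservesClopen hf)))
      (E : (PSI.AlgCat.{u} j)ᵒᵖ ≌ PSI.SpCat.{u} j),
        E.functor = PSI.ultFunctor j hG hG' ∧ E.inverse = PSI.clopenFunctor j hH hH' :=
  ⟨fun A => PSI.isPSISpace_ult A.isPSI, PSI.isSpMor_comap, PSI.isPSIAlgebra_clopens,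
    PSI.isAlgMor_clopenComap, PSI.dualEquivalence j, rfl, rfl⟩
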